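/- A non-commutative noetherian scheme $\mathbb{X}=(X,\mathcal{A})$ consists of a separated noetherian scheme $X$ with structure sheaf $\mathcal{O}$ and a sheaf $\mathcal{A}$ of (not necessarily commutative, unital) $\mathcal{O}$-algebras that is coherent as an $\mathcal{O}$-module. Let $\mathsf{Qcoh}(\mathbb{X})$ be the category of sheaves of left $\mathcal{A}$-modules that are quasi-coherent as $\mathcal{O}$-modules. The center $Z(R)$ of a ring $R$ is the usual one, and the categorical center $Z(\mathsf{C})$ of an additive category $\mathsf{C}$ is the ring of endomorphisms of the identity functor of $\mathsf{C}$. **Proposition.** Let $\mathbb{X}=(X,\mathcal{A})$ be a non-commutative noetherian scheme. For every open $U\subseteq X$ put $$\Gamma(U,\mathcal{Z}_{\mathcal{A}}) := \bigl\{\alpha\in\Gamma(U,\mathcal{A}) \;\big|\; \alpha|_V\in Z\bigl(\Gamma(V,\mathcal{A})\bigr)\ \text{for all open } V\subseteq U\bigr\}.$$ Then: 1. $\mathcal{Z}=\mathcal{Z}_{\mathcal{A}}$, with the restriction maps of $\mathcal{A}$, is a sheaf of $\mathcal{O}$-algebras on $X$ which is coherent as an $\mathcal{O}$-module. 2. For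 every $x\in X$, the map of stalks $\mathcal{Z}_x\to\mathcal{A}_x$ induced by the inclusion $\mathcal{Z}\subseteq\mathcal{A}$ is a ring isomorphism of $\mathcal{Z}_x$ onto the center $Z(\mathcal{A}_x)$. 3. The canonical map $\upsilon_{\mathbb{X}}\colon\Gamma(X,\mathcal{Z})\to Z\bigl(\mathsf{Qcoh}(\mathbb{X})\bigr)$, which sends $\alpha$ to the family of endomorphisms $\alpha_{\mathcal{F}}\colon\mathcal{F}\to\mathcal{F}$, $f\mapsto\alpha|_U\cdot f$ for $f\in\Gamma(U,\mathcal{F})$, is a ring isomorphism. -/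

import Mathlib

open CategoryTheory AlgebraicGeometry TopologicalSpace Opposite

universe u

/-- An `𝒪`-module `M` on a (locally noetherian) scheme `X` is coherent if it is quasi-coherent and
its sections over each affine open `U` form a finitely generated `Γ(X, U)`-module. -/
def IsCoherentModule {X : Scheme.{u}} (M : SheafOfModules.{u} X.ringCatSheaf) : Prop :=
  M.IsQuasicoherent ∧
    ∀ U : X.Opens, IsAffineOpen U →
      Module.Finite (X.ringCatSheaf.obj.obj (op U)) (M.val.obj (op U))

/-- A sheaf of rings `A` over `𝒪`, regarded as a sheaf of `𝒪`-modules along `φ : 𝒪 ⟶ A`. -/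
noncomputable def algebraAsModule {X : Scheme.{u}}
    {A : Sheaf (Opens.grothendieckTopology X) RingCat.{u}}
    (φ : X.ringCatSheaf ⟶ A) : SheafOfModules.{u} X.ringCatSheaf :=
  (SheafOfModules.restrictScalars φ).obj (SheafOfModules.unit A)

/-- A non-commutative noetherian scheme `(X, A)`: a separated noetherian scheme `X` with a sheaf
`A` of (not necessarily commutative) `𝒪`-algebras which is coherent as an `𝒪`-module. The algebra
structure is given by a morphism of sheaves of rings `𝒪 ⟶ A` with central image. -/
structure NCNScheme where
  /-- the underlying commutative scheme -/
  X : Scheme.{u}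
  isSeparated : X.IsSeparated
  isNoetherian : AlgebraicGeometry.IsNoetherian X
  /-- the sheaf of algebras -/
  A : Sheaf (Opens.grothendieckTopology X) RingCat.{u}
  /-- the structure morphism of the sheaf of `𝒪`-algebras `A` -/
  φ : X.ringCatSheaf ⟶ A
  map_mem_center : ∀ (U : X.Opens) (r : X.ringCatSheaf.obj.obj (op U)),
    φ.hom.app (op U) r ∈ Subring.center (A.obj.obj (op U))
  isCoherent : IsCoherentModule (algebraAsModule φ)

namespace NCNScheme

variable (S : NCNScheme.{u})

/-- The property of a sheaf of left `A`-modules of being quasi-coherent as an `𝒪`-module. -/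
def isQcoh : ObjectProperty (SheafOfModules.{u} S.A) := fun M =>
  SheafOfModules.IsQuasicoherent ((SheafOfModules.restrictScalars S.φ).obj M)

/-- The category of sheaves of left `A`-modules which are quasi-coherent as `𝒪`-modules. -/
abbrev Qcoh := S.isQcoh.FullSubcategory

/-- The sections `α` of `A` over `U` such that `α|_V` is central in `Γ(V, A)` for all open
`V ⊆ U`. -/
def centralSections (U : S.X.Opens) : Subring (S.A.obj.obj (op U)) :=
  ⨅ (V : S.X.Opens) (h : V ≤ U),
    (Subring.center (S.A.obj.obj (op V))).comap (S.A.obj.map (homOfLE h).op).hom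

lemma mem_centralSections {U : S.X.Opens} {a : S.A.obj.obj (op U)} :
    a ∈ S.centralSections U ↔ ∀ (V : S.X.Opens) (h : V ≤ U),
      S.A.obj.map (homOfLE h).op a ∈ Subring.center (S.A.obj.obj (op V)) := by
  simp [centralSections, Subring.mem_iInf]

lemma map_mem_centralSections {U V : S.X.Opens} (h : V ⟶ U) {a : S.A.obj.obj (op U)}
    (ha : a ∈ S.centralSections U) : S.A.obj.map h.op a ∈ S.centralSections V := by
  rw [mem_centralSections] at ha ⊢
  intro W hW
  have := ha W (hW.trans h.le)
  rw [← ConcreteCategory.comp_apply, ← S.A.obj.map_comp]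
  exact this

lemma structure_mem_centralSections (U : S.X.Opens) (r : S.X.ringCatSheaf.obj.obj (op U)) :
    S.φ.hom.app (op U) r ∈ S.centralSections U := by
  rw [mem_centralSections]
  intro V h
  rw [← ConcreteCategory.comp_apply, ← S.φ.hom.naturality, ConcreteCategory.comp_apply]
  exact S.map_mem_center V _

/-- The presheaf of rings `Z_A`. -/
def centralPresheaf : TopCat.Presheaf RingCat.{u} S.X where
  obj U := RingCat.of (S.centralSections U.unop)
  map {U V} f := RingCat.ofHom
    (((S.A.obj.map f).hom.comp (S.centralSections U.unop).subtype).codRestrict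
      (S.centralSections V.unop) fun a => S.map_mem_centralSections f.unop a.2)
  map_id U := by
    ext a
    exact congr($(S.A.obj.map_id U) a.1)
  map_comp f g := by
    ext a
    exact congr($(S.A.obj.map_comp f g) a.1)

/-- The inclusion `Z_A ⟶ A`. -/
def centralInclusion : S.centralPresheaf ⟶ S.A.obj where
  app U := RingCat.ofHom (S.centralSections U.unop).subtype

/-- The structure map `𝒪 ⟶ Z_A`, given by the structure map of `A`. -/
def centralStructure : S.X.ringCatSheaf.obj ⟶ S.centralPresheaf where
  app U := RingCat.ofHom ((S.φ.hom.app U).hom.codRestrict (S.centralSections U.unop)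
    fun r => S.structure_mem_centralSections U.unop r)
  naturality U V f := by
    ext r
    apply Subtype.ext
    exact congr($(S.φ.hom.naturality f) r)

/-- `Z_A` as a sheaf of rings, once it is known to be a sheaf. -/
def centralSheaf (h : S.centralPresheaf.IsSheaf) :
    Sheaf (Opens.grothendieckTopology S.X) RingCat.{u} :=
  ⟨S.centralPresheaf, h⟩

/-- The structure map of the sheaf of `𝒪`-algebras `Z_A`. -/
def centralSheafStructure (h : S.centralPresheaf.IsSheaf) :
    S.X.ringCatSheaf ⟶ S.centralSheaf h :=
  ⟨S.centralStructure⟩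

/-- The underlying presheaf of rings of `A`. -/
abbrev algebraPresheaf : TopCat.Presheaf RingCat.{u} S.X := S.A.obj

/-- The induced map on stalks `(Z_A)_x ⟶ A_x`. -/
noncomputable def centralStalkMap (x : S.X) :
    S.centralPresheaf.stalk x ⟶ S.algebraPresheaf.stalk x :=
  (TopCat.Presheaf.stalkFunctor RingCat.{u} x).map S.centralInclusion

/-- The restriction of a global section of `A` to `U`. -/
def res (U : S.X.Opens) : S.A.obj.obj (op ⊤) →+* S.A.obj.obj (op U) :=
  (S.A.obj.map (homOfLE (le_top : U ≤ ⊤)).op).hom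

lemma map_res {U V : S.X.Opens} (f : V ⟶ U) (a : S.A.obj.obj (op ⊤)) :
    S.A.obj.map f.op (S.res U a) = S.res V a := by
  change (S.A.obj.map _ ≫ S.A.obj.map _) a = _
  rw [← S.A.obj.map_comp]
  rfl

lemma res_mul_comm (a : S.centralSections ⊤) (U : S.X.Opens) (b : S.A.obj.obj (op U)) :
    S.res U a.1 * b = b * S.res U a.1 :=
  ((Subring.mem_center_iff.1 (S.mem_centralSections.1 a.2 U le_top)) b).symm

/-- The endomorphism of a sheaf of `A`-modules `M` given by `m ↦ α|_U • m` for `m ∈ Γ(U, M)`. -/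
def centralAction (a : S.centralSections ⊤) (M : SheafOfModules.{u} S.A) : M ⟶ M where
  val :=
    { app := fun U => ModuleCat.ofHom
        { toFun := fun m => S.res U.unop a.1 • m
          map_add' := fun m n => smul_add _ m n
          map_smul' := fun b m => by
            change S.res U.unop a.1 • b • m = b • S.res U.unop a.1 • m
            rw [smul_smul, S.res_mul_comm a U.unop b, smul_smul] }
      naturality := fun {U V} f => by
        ext m
        change S.res V.unop a.1 • M.val.map f m = M.val.map f (S.res U.unop a.1 • m)
        rw [PresheafOfModules.map_smul]
        congr 1
        exact (S.map_res f.unop a.1).symm }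

/-- The canonical ring homomorphism from the global sections of `Z_A` to the categorical center of
the category of quasi-coherent `A`-modules. -/
def upsilon : S.centralPresheaf.obj (op ⊤) →+* CatCenter S.Qcoh where
  toFun a :=
    { app := fun M => ObjectProperty.homMk (S.centralAction a M.obj)
      naturality := fun M N f => by
        ext U m
        exact ((f.hom.val.app U).hom.map_smul (S.res U.unop a.1) m).symm }
  map_one' := by
    ext M U m
    change S.res U.unop 1 • m = m
    rw [map_one, one_smul]
  map_mul' a b := by
    ext M U m
    change S.res U.unop (a.1 * b.1) • m = S.res U.unop a.1 • S.res U.unop b.1 • m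
    rw [map_mul, mul_smul]
  map_zero' := by
    ext M U m
    change S.res U.unop 0 • m = 0
    rw [map_zero, zero_smul]
  map_add' a b := by
    ext M U m
    change S.res U.unop (a.1 + b.1) • m = S.res U.unop a.1 • m + S.res U.unop b.1 • m
    rw [map_add, add_smul]

end NCNScheme

/-! ### Quasi-coherence as a localization property on affine opens. -/

namespace AlgebraicGeometry.Scheme.Modules
variable {X : Scheme.{u}}

/-! Everything reduces to affine opens `U`, where quasi-coherence says that sections over `D(f)` are
the localization at `f` of those over `U` (`isQcoh_iff`). As `Γ(U, A)` is a finite `Γ(U, 𝒪)`-module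
and scalars are central, centrality amounts to commuting with finitely many generators. Finitely
many linear conditions survive localization: one power of `f` kills all the commutators, and one
neighbourhood serves for all of them. This gives quasi-coherence of `Z_A` and the stalks; finiteness
holds because `Z_A ⊆ A` and `X` is noetherian.

For the categorical center, let `ζ` act on `A` and let `c` be the image of `1`. Naturality along the
maps `A ⟶ N`, `1 ↦ m`, shows that `ζ` multiplies global sections by `c`. Sections over an affine `U`
are global sections of `j_* j^* N`, which is quasi-coherent because `X` is separated
(`isQcoh_infPushforward`); naturality along `N ⟶ j_* j^* N` then settles affine opens, hence all
opens. Linearity of `ζ` on `A` makes `c` central. -/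

/-- For every affine open `U` and `f ∈ Γ(U, 𝒪)`, the sections of `M` over `D(f)` are the
localization at `f` of the sections over `U`. -/
def IsLocalizingOnAffines (M : X.Modules) : Prop :=
  ∀ ⦃U : X.Opens⦄, IsAffineOpen U → ∀ f : Γ(X, U),
    (∀ s : Γ(M, X.basicOpen f), ∃ (n : ℕ) (t : Γ(M, U)),
      M.presheaf.map (homOfLE (X.basicOpen_le f)).op t =
        X.presheaf.map (homOfLE (X.basicOpen_le f)).op f ^ n • s) ∧
    ∀ t : Γ(M, U), M.presheaf.map (homOfLE (X.basicOpen_le f)).op t = 0 → ∃ n : ℕ, f ^ n • t = 0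

lemma map_map_homOfLE (M : X.Modules) {U V W : X.Opens} (h : V ≤ U) (h' : W ≤ V) (x : Γ(M, U)) :
    M.presheaf.map (homOfLE h').op (M.presheaf.map (homOfLE h).op x) =
      M.presheaf.map (homOfLE (h'.trans h)).op x := by
  rw [← M.presheaf.map_comp_apply, ← op_comp, homOfLE_comp]

lemma map_homOfLE_self (M : X.Modules) {U : X.Opens} (h : U ≤ U) (x : Γ(M, U)) :
    M.presheaf.map (homOfLE h).op x = x :=
  congr($(M.presheaf.map_id (op U)) x)

lemma _root_.AlgebraicGeometry.IsAffineOpen.fromSpec_image_le {U : X.Opens} (hU : IsAffineOpen U)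
    (V : (Spec Γ(X, U)).Opens) : hU.fromSpec ''ᵁ V ≤ U := by
  exact (hU.fromSpec.image_le_opensRange V).trans hU.opensRange_fromSpec.le

lemma _root_.AlgebraicGeometry.IsAffineOpen.fromSpec_appIso_inv {U : X.Opens} (hU : IsAffineOpen U)
    (V : (Spec Γ(X, U)).Opens) (r : Γ(X, U)) :
    (hU.fromSpec.appIso V).inv ((Spec Γ(X, U)).presheaf.map V.leTop.op
      ((Scheme.ΓSpecIso Γ(X, U)).inv r)) =
      X.presheaf.map (homOfLE (hU.fromSpec_image_le V)).op r := by
  rw [← ConcreteCategory.comp_apply, ← ConcreteCategory.comp_apply]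
  congr 2
  rw [← Category.assoc, Iso.comp_inv_eq, Scheme.Hom.appIso_hom', Scheme.Hom.map_appLE,
   Scheme.Hom.appLE, hU.fromSpec_app_self]
  simp only [Category.assoc, ← Functor.map_comp]
  rfl

lemma restrict_fromSpec_smul (M : X.Modules) {U : X.Opens} (hU : IsAffineOpen U)
    (V : (Spec Γ(X, U)).Opens) (r : Γ(X, U)) (x : Γ(M.restrict hU.fromSpec, V)) :
    (M.restrictAppIso hU.fromSpec V).hom (r • x) =
      X.presheaf.map (homOfLE (hU.fromSpec_image_le V)).op r •
        (M.restrictAppIso hU.fromSpec V).hom x := by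
  rw [smul_Spec_def, smul_restrictAppIso_hom_apply, hU.fromSpec_appIso_inv]

/-- Since `f` always acts invertibly over `D(f)`, only the surjectivity and kernel conditions of a
localization remain. -/
lemma isLocalizing_iff {R : CommRingCat.{u}} (N : (Spec R).Modules) :
    IsLocalizing (modulesSpecToSheaf.obj N) ↔ ∀ (f : R) (D : (Spec R).Opens),
      D = PrimeSpectrum.basicOpen f →
      (∀ s : Γ(N, D), ∃ (n : ℕ) (t : Γ(N, ⊤)), N.presheaf.map D.leTop.op t = f ^ n • s) ∧
      ∀ t : Γ(N, ⊤), N.presheaf.map D.leTop.op t = 0 → ∃ n : ℕ, f ^ n • t = 0 := by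
  let φ (f : R) := ((modulesSpecToSheaf.obj N).obj.map (PrimeSpectrum.basicOpen f).leTop.op).hom
  refine forall_congr' fun f => ⟨?_, fun h => ?_⟩
  · rintro h D rfl
    have hf : IsLocalizedModule (Submonoid.powers f) (φ f) := h
    refine ⟨fun s => ?_, fun t ht => ?_⟩
    · obtain ⟨⟨t, ⟨_, n, rfl⟩⟩, ht⟩ := IsLocalizedModule.surj (.powers f) (φ f) s
      exact ⟨n, t, ht.symm⟩
    · obtain ⟨⟨_, n, rfl⟩, hn⟩ := (IsLocalizedModule.eq_zero_iff (.powers f) (φ f)).mp ht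
      exact ⟨n, hn⟩
  · obtain ⟨h₁, h₂⟩ := h _ rfl
    refine IsLocalizedModule.Away.mk_of_addCommGroup
      (N.isUnit_algebraMap_end_of_le_basicOpen f le_rfl) (fun s => ?_) h₂
    obtain ⟨n, t, ht⟩ := h₁ s
    exact ⟨n, t, ht.symm⟩

/-- Transport along `Spec Γ(X, U) ≅ U`. The images of `⊤` and `D(f)` are only propositionally `U`
and `X.basicOpen f`, so restriction maps along these equalities mediate. -/
lemma isLocalizing_restrict_fromSpec_iff (M : X.Modules) {U : X.Opens} (hU : IsAffineOpen U) :
    IsLocalizing (modulesSpecToSheaf.obj (M.restrict hU.fromSpec)) ↔ ∀ f : Γ(X, U),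
    (∀ s : Γ(M, X.basicOpen f), ∃ (n : ℕ) (t : Γ(M, U)),
      M.presheaf.map (homOfLE (X.basicOpen_le f)).op t =
        X.presheaf.map (homOfLE (X.basicOpen_le f)).op f ^ n • s) ∧
    ∀ t : Γ(M, U), M.presheaf.map (homOfLE (X.basicOpen_le f)).op t = 0 →
      ∃ n : ℕ, f ^ n • t = 0 := by
  have htop : hU.fromSpec ''ᵁ ⊤ = U := by
    rw [Scheme.Hom.image_top_eq_opensRange, hU.opensRange_fromSpec]
  rw [isLocalizing_iff]
  refine forall_congr' fun f => ?_
  let D : (Spec Γ(X, U)).Opens := PrimeSpectrum.basicOpen f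
  have hf : hU.fromSpec ''ᵁ D = X.basicOpen f := hU.fromSpec_image_basicOpen f
  let e := M.restrictAppIso hU.fromSpec
  have he (V) : Function.Bijective (e V).hom := ConcreteCategory.bijective_of_isIso _
  have hmap (x : Γ(M.restrict hU.fromSpec, ⊤)) :
      (e D).hom ((M.restrict hU.fromSpec).presheaf.map D.leTop.op x) =
        M.presheaf.map (homOfLE (hU.fromSpec.image_mono le_top)).op ((e ⊤).hom x) := rfl
  have hpow (V) (n : ℕ) (x : Γ(M.restrict hU.fromSpec, V)) : (e V).hom (f ^ n • x) =
      X.presheaf.map (homOfLE (hU.fromSpec_image_le V)).op f ^ n • (e V).hom x := by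
    rw [← map_pow]
    exact M.restrict_fromSpec_smul hU V (f ^ n) x
  have hX {U V W : X.Opens} (h : V ≤ U) (h' : W ≤ V) (x : Γ(X, U)) :
    X.presheaf.map (homOfLE h').op (X.presheaf.map (homOfLE h).op x) =
      X.presheaf.map (homOfLE (h'.trans h)).op x := by
    rw [← ConcreteCategory.comp_apply, ← X.presheaf.map_comp]
    rfl
  have hX' {U : X.Opens} (h : U ≤ U) (x : Γ(X, U)) : X.presheaf.map (homOfLE h).op x = x :=
    congr($(X.presheaf.map_id (op U)) x)
  constructor
  · intro h
    obtain ⟨h₁, h₂⟩ := h D rfl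
    refine ⟨fun s => ?_, fun t ht => ?_⟩
    · obtain ⟨s', hs'⟩ := (he _).2 (M.presheaf.map (homOfLE hf.le).op s)
      obtain ⟨n, t, ht⟩ := h₁ s'
      refine ⟨n, M.presheaf.map (homOfLE htop.ge).op ((e _).hom t), ?_⟩
      have := congr(M.presheaf.map (homOfLE hf.ge).op ((e _).hom $ht))
      rwa [hmap, hpow, hs', map_smul, map_pow, map_map_homOfLE, map_map_homOfLE,
        map_homOfLE_self, hX, ← map_map_homOfLE M htop.ge (X.basicOpen_le f)] at this
    · obtain ⟨t', ht'⟩ := (he _).2 (M.presheaf.map (homOfLE htop.le).op t)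
      obtain ⟨n, hn⟩ := h₂ t' <| (he _).1 <| by
        rw [hmap, ht', map_map_homOfLE, map_zero, ← map_map_homOfLE M (X.basicOpen_le f) hf.le, ht,
          map_zero]
      refine ⟨n, ?_⟩
      have := congr(M.presheaf.map (homOfLE htop.ge).op ((e _).hom $hn))
      rwa [hpow, ht', map_smul, map_pow, map_map_homOfLE, map_homOfLE_self, map_zero, map_zero, hX,
        hX'] at this
  · rintro ⟨h₁, h₂⟩ _ rfl
    refine ⟨fun s => ?_, fun t ht => ?_⟩
    · obtain ⟨n, t, ht⟩ := h₁ (M.presheaf.map (homOfLE hf.ge).op ((e D).hom s))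
      obtain ⟨t', ht'⟩ := (he _).2 (M.presheaf.map (homOfLE htop.le).op t)
      refine ⟨n, t', (he D).1 ?_⟩
      have := congr(M.presheaf.map (homOfLE hf.le).op $ht)
      rw [map_map_homOfLE, map_smul, map_pow, map_map_homOfLE, map_homOfLE_self, hX] at this
      rw [hmap, ht', hpow, map_map_homOfLE, this]
    · have := congr(M.presheaf.map (homOfLE hf.ge).op ((e D).hom $ht))
      rw [hmap, map_map_homOfLE, map_zero, map_zero] at this
      obtain ⟨n, hn⟩ := h₂ (M.presheaf.map (homOfLE htop.ge).op ((e _).hom t)) (by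
        rw [map_map_homOfLE, this])
      refine ⟨n, (he _).1 ?_⟩
      have := congr(M.presheaf.map (homOfLE htop.le).op $hn)
      rwa [map_smul, map_pow, map_map_homOfLE, map_homOfLE_self, map_zero, ← hpow,
        ← map_zero (e _).hom.hom] at this

lemma isLocalizingOnAffines_of_isQuasicoherent (M : X.Modules) [M.IsQuasicoherent] :
    M.IsLocalizingOnAffines := by
  intro U hU
  rw [← isLocalizing_restrict_fromSpec_iff M hU, ← isIso_fromTildeΓ_iff_isLocalizing]
  infer_instance

/-- Transport of a presentation along an isomorphism of `𝒪`-modules. -/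
noncomputable def presentationOfIso {M N : X.Modules} (e : M ≅ N)
    (p : SheafOfModules.Presentation.{u} M) : SheafOfModules.Presentation.{u} N :=
  haveI : IsIso (C := SheafOfModules.{u} X.ringCatSheaf) e.hom := by
    exact inferInstanceAs (IsIso e.hom)
  p.ofIsIso e.hom

/-- The converse of `isLocalizingOnAffines_of_isQuasicoherent`. -/
lemma isQuasicoherent_of_isLocalizingOnAffines (M : X.Modules) (hM : M.IsLocalizingOnAffines) :
    M.IsQuasicoherent := by
  have (U : X.affineOpens) : Nonempty (M.over U.1).Presentation := by
    obtain ⟨U, hU : IsAffineOpen U⟩ := U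
    have := (isIso_fromTildeΓ_iff_isLocalizing _).2
      ((isLocalizing_restrict_fromSpec_iff M hU).2 (hM hU))
    -- The pullback to `Spec` is the tilde of its global sections; take all sections as generators
    -- and all relations. The remaining steps carry this presentation to `U` and then to the slice
    -- site.
    let p₁ := presentationOfIso (asIso (M.restrict hU.fromSpec).fromTildeΓ)
      (presentationTilde _ .univ (by simp) _ (Submodule.span_eq _))
    let p₂ : (M.restrict U.ι).Presentation := presentationOfIso
      (((restrictFunctorComp hU.isoSpec.hom hU.fromSpec).symm ≪≫
        restrictFunctorCongr (by simp)).app M)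
      (presentationRestrict hU.isoSpec.hom p₁)
    let p₃ : ((overEquiv U).functor.obj (M.over U)).Presentation :=
      presentationOfIso ((overFunctorEquiv U).app M).symm p₂
    let E := Opens.sheafOfModulesEquivOver.{u} U X.ringCatSheaf
    have : Limits.PreservesColimitsOfSize.{u, u} E.inverse := inferInstance
    let p₄ := SheafOfModules.Presentation.map (M := E.functor.obj (M.over U)) p₃ E.inverse
      (Opens.sheafOfModulesEquivOverInverseUnit U X.ringCatSheaf).symm
    exact ⟨p₄.ofIsIso (E.unitIso.symm.hom.app (M.over U))⟩
  refine SheafOfModules.QuasicoherentData.isQuasicoherent.{u, u, u, u} (M := M)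
    { I := X.affineOpens
      X := fun U => U.1
      coversTop := ?_
      presentation := fun U => (this U).some }
  rw [Opens.coversTop_iff]
  exact iSup_affineOpens_eq_top X
end AlgebraicGeometry.Scheme.Modules

/-! ### Sections of `A` and of `A`-modules over affine opens. -/

namespace NCNScheme

variable (S : NCNScheme.{u})

/-- The structure map `Γ(U, 𝒪) → Γ(U, A)`. -/
def str (U : S.X.Opens) : Γ(S.X, U) →+* S.A.obj.obj (op U) :=
  (S.φ.hom.app (op U)).hom

/-- The restriction maps of `A`. -/
def ringRes {U V : S.X.Opens} (h : V ≤ U) : S.A.obj.obj (op U) →+* S.A.obj.obj (op V) :=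
  (S.A.obj.map (homOfLE h).op).hom

lemma ringRes_ringRes {U V W : S.X.Opens} (h : V ≤ U) (h' : W ≤ V) (a : S.A.obj.obj (op U)) :
    S.ringRes h' (S.ringRes h a) = S.ringRes (h'.trans h) a := by
  change (S.A.obj.map _ ≫ S.A.obj.map _) a = _
  rw [← S.A.obj.map_comp]
  rfl

lemma ringRes_self {U : S.X.Opens} (h : U ≤ U) (a : S.A.obj.obj (op U)) : S.ringRes h a = a :=
  congr($(S.A.obj.map_id (op U)) a)

lemma ringRes_str {U V : S.X.Opens} (h : V ≤ U) (r : Γ(S.X, U)) :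
    S.ringRes h (S.str U r) = S.str V (S.X.presheaf.map (homOfLE h).op r) :=
  congr($(S.φ.hom.naturality (homOfLE h).op) r).symm

lemma str_mul_comm {U : S.X.Opens} (r : Γ(S.X, U)) (a : S.A.obj.obj (op U)) :
    S.str U r * a = a * S.str U r :=
  (Subring.mem_center_iff.1 (S.map_mem_center U r) a).symm

lemma ring_section_ext {U : S.X.Opens} {a b : S.A.obj.obj (op U)}
    (h : ∀ x ∈ U, ∃ V, ∃ hV : V ≤ U, x ∈ V ∧ S.ringRes hV a = S.ringRes hV b) : a = b :=
  TopCat.Presheaf.IsSheaf.section_ext S.A.2 h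

variable {S}

/-- The restriction maps of a sheaf of `A`-modules. -/
noncomputable def secRes (N : SheafOfModules.{u} S.A) {U V : S.X.Opens} (h : V ≤ U) :
    N.val.obj (op U) →+ N.val.obj (op V) :=
  (N.val.presheaf.map (homOfLE h).op).hom

lemma secRes_secRes (N : SheafOfModules.{u} S.A) {U V W : S.X.Opens} (h : V ≤ U) (h' : W ≤ V)
    (m : N.val.obj (op U)) : secRes N h' (secRes N h m) = secRes N (h'.trans h) m := by
  change (N.val.presheaf.map _ ≫ N.val.presheaf.map _) m = _
  rw [← N.val.presheaf.map_comp]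
  rfl

lemma secRes_self (N : SheafOfModules.{u} S.A) {U : S.X.Opens} (h : U ≤ U)
    (m : N.val.obj (op U)) : secRes N h m = m :=
  congr($(N.val.presheaf.map_id (op U)) m)

lemma secRes_smul (N : SheafOfModules.{u} S.A) {U V : S.X.Opens} (h : V ≤ U)
    (a : S.A.obj.obj (op U)) (m : N.val.obj (op U)) :
    secRes N h (a • m) = S.ringRes h a • secRes N h m :=
  N.val.map_smul (homOfLE h).op a m

lemma section_ext (N : SheafOfModules.{u} S.A) {U : S.X.Opens} {m n : N.val.obj (op U)}
    (h : ∀ x ∈ U, ∃ V, ∃ hV : V ≤ U, x ∈ V ∧ secRes N hV m = secRes N hV n) : m = n :=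
  TopCat.Presheaf.IsSheaf.section_ext N.isSheaf h

/-- Over every affine open `U` and `f ∈ Γ(U, 𝒪)`, the sections of `N` over `D(f)` are the
localization at `f` of the sections over `U`. -/
lemma isQcoh_iff (N : SheafOfModules.{u} S.A) :
    S.isQcoh N ↔ ∀ ⦃U : S.X.Opens⦄, IsAffineOpen U → ∀ f : Γ(S.X, U),
      (∀ s : N.val.obj (op (S.X.basicOpen f)), ∃ (n : ℕ) (t : N.val.obj (op U)),
        secRes N (S.X.basicOpen_le f) t = S.ringRes (S.X.basicOpen_le f) (S.str U f) ^ n • s) ∧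
      ∀ t : N.val.obj (op U), secRes N (S.X.basicOpen_le f) t = 0 →
        ∃ n : ℕ, S.str U f ^ n • t = 0 := by
  let M : S.X.Modules := (SheafOfModules.restrictScalars S.φ).obj N
  have hM : S.isQcoh N ↔ M.IsLocalizingOnAffines :=
    ⟨fun (h : M.IsQuasicoherent) => M.isLocalizingOnAffines_of_isQuasicoherent,
      M.isQuasicoherent_of_isLocalizingOnAffines⟩
  rw [hM]
  refine forall_congr' fun U => forall_congr' fun hU => forall_congr' fun f => ?_
  have smul_eq (V) (r : Γ(S.X, V)) (n : ℕ) (m : N.val.obj (op V)) :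
      S.str V r ^ n • m = (show Γ(M, V) from (r ^ n • show Γ(M, V) from m)) := by
    rw [← map_pow]
    rfl
  simp_rw [ringRes_str, smul_eq]
  rfl

variable (S)

lemma isQcoh_unit : S.isQcoh (SheafOfModules.unit S.A) := S.isCoherent.1

lemma exists_pow_mul_eq_ringRes {U : S.X.Opens} (hU : IsAffineOpen U) (f : Γ(S.X, U))
    (s : S.A.obj.obj (op (S.X.basicOpen f))) :
    ∃ (n : ℕ) (t : S.A.obj.obj (op U)), S.ringRes (S.X.basicOpen_le f) t =
      S.ringRes (S.X.basicOpen_le f) (S.str U f) ^ n * s :=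
  ((isQcoh_iff _).1 S.isQcoh_unit hU f).1 s

lemma exists_pow_mul_eq_zero {U : S.X.Opens} (hU : IsAffineOpen U) (f : Γ(S.X, U))
    (t : S.A.obj.obj (op U)) (ht : S.ringRes (S.X.basicOpen_le f) t = 0) :
    ∃ n : ℕ, S.str U f ^ n * t = 0 :=
  ((isQcoh_iff _).1 S.isQcoh_unit hU f).2 t ht

lemma isUnit_ringRes_str {U : S.X.Opens} (f : Γ(S.X, U)) :
    IsUnit (S.ringRes (S.X.basicOpen_le f) (S.str U f)) := by
  rw [ringRes_str]
  exact (S.X.toRingedSpace.isUnit_res_basicOpen f).map _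

/-- Module generators over `Γ(U, 𝒪)`, phrased with subrings so as to apply directly to centralizers.
-/
lemma exists_finset_generators {U : S.X.Opens} (hU : IsAffineOpen U) :
    ∃ G : Finset (S.A.obj.obj (op U)), ∀ T : Subring (S.A.obj.obj (op U)),
      (∀ r : Γ(S.X, U), S.str U r ∈ T) → (∀ g ∈ G, g ∈ T) → ∀ b, b ∈ T := by
  let M : S.X.Modules := algebraAsModule S.φ
  have : Module.Finite Γ(S.X, U) Γ(M, U) := S.isCoherent.2 U hU
  obtain ⟨G, hG⟩ := this.fg_top
  refine ⟨G, fun T hr hT b => ?_⟩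
  let b' : Γ(M, U) := b
  have hb : b' ∈ Submodule.span Γ(S.X, U) (G : Set Γ(M, U)) := hG ▸ Submodule.mem_top
  refine Submodule.span_induction (p := fun (c : Γ(M, U)) _ => c ∈ T.toAddSubgroup)
    hT (zero_mem T) (fun _ _ _ _ => add_mem) (fun r x _ hx => ?_) hb
  exact T.mul_mem (hr r) hx

/-! ### Central sections: sheaf property and coherence. -/

/-- A section over `D(f)` commuting with all sections over the affine open `U` is central. -/
lemma mem_center_of_commute {U : S.X.Opens} (hU : IsAffineOpen U) (f : Γ(S.X, U))
    (a : S.A.obj.obj (op (S.X.basicOpen f)))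
    (h : ∀ b : S.A.obj.obj (op U), Commute (S.ringRes (S.X.basicOpen_le f) b) a) :
    a ∈ Subring.center (S.A.obj.obj (op (S.X.basicOpen f))) := by
  rw [Subring.mem_center_iff]
  intro b
  obtain ⟨n, t, ht⟩ := S.exists_pow_mul_eq_ringRes hU f b
  have h₁ := h t
  rw [ht] at h₁
  have h₂ : Commute (S.ringRes (S.X.basicOpen_le f) (S.str U f) ^ n) a := (h _).pow_left n
  -- A power of `f` times `b` extends to `U`, and `f` is invertible over `D(f)`.
  refine ((S.isUnit_ringRes_str f).pow n).mul_left_cancel ?_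
  rw [← mul_assoc, h₁.eq, ← mul_assoc, ← mul_assoc, h₂.eq]

/-- A section over `D(f)` commuting with the generators over the affine open `U` is central. -/
lemma mem_center_of_commute_generators {U : S.X.Opens} (hU : IsAffineOpen U)
    {G : Finset (S.A.obj.obj (op U))} (hG : ∀ T : Subring (S.A.obj.obj (op U)),
      (∀ r : Γ(S.X, U), S.str U r ∈ T) → (∀ g ∈ G, g ∈ T) → ∀ b, b ∈ T) (f : Γ(S.X, U))
    (a : S.A.obj.obj (op (S.X.basicOpen f)))
    (h : ∀ g ∈ G, Commute (S.ringRes (S.X.basicOpen_le f) g) a) :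
    a ∈ Subring.center (S.A.obj.obj (op (S.X.basicOpen f))) := by
  refine S.mem_center_of_commute hU f a fun b => ?_
  have hT := hG ((Subring.centralizer {a}).comap (S.ringRes (S.X.basicOpen_le f)))
    (fun r => ?_) (fun g hg => ?_) b
  · exact (Subring.mem_centralizer_iff.1 hT a rfl).symm
  · refine Subring.mem_centralizer_iff.2 ?_
    rintro _ rfl
    rw [ringRes_str, str_mul_comm]
  · refine Subring.mem_centralizer_iff.2 ?_
    rintro _ rfl
    exact (h g hg).symm

lemma mem_centralSections_iff {U : S.X.Opens} {a : S.A.obj.obj (op U)} :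
    a ∈ S.centralSections U ↔ ∀ (V : S.X.Opens) (h : V ≤ U),
      S.ringRes h a ∈ Subring.center (S.A.obj.obj (op V)) :=
  S.mem_centralSections

lemma mem_center_of_mem_centralSections {U : S.X.Opens} {a : S.A.obj.obj (op U)}
    (ha : a ∈ S.centralSections U) : a ∈ Subring.center (S.A.obj.obj (op U)) := by
  simpa only [ringRes_self] using S.mem_centralSections_iff.1 ha U le_rfl

/-- Being a central section can be checked locally. -/
lemma mem_centralSections_of_locally {U : S.X.Opens} {a : S.A.obj.obj (op U)}
    (h : ∀ (V : S.X.Opens), V ≤ U → ∀ x ∈ V, ∃ (W : S.X.Opens) (hW : W ≤ U), W ≤ V ∧ x ∈ W ∧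
      S.ringRes hW a ∈ Subring.center (S.A.obj.obj (op W))) :
    a ∈ S.centralSections U := by
  rw [mem_centralSections_iff]
  intro V hV
  rw [Subring.mem_center_iff]
  intro b
  refine S.ring_section_ext fun x hx => ?_
  obtain ⟨W, hW, hWV, hxW, hc⟩ := h V hV x hx
  refine ⟨W, hWV, hxW, ?_⟩
  rw [map_mul, map_mul, ringRes_ringRes]
  exact Subring.mem_center_iff.1 hc _

/-- Any open inside `U` is covered by basic opens `D(f)`, and centrality passes from `U` to `D(f)`.
-/
lemma mem_centralSections_of_mem_center {U : S.X.Opens} (hU : IsAffineOpen U)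
    {a : S.A.obj.obj (op U)} (ha : a ∈ Subring.center (S.A.obj.obj (op U))) :
    a ∈ S.centralSections U := by
  refine S.mem_centralSections_of_locally fun V hV x hx => ?_
  obtain ⟨f, hf, hxf⟩ := hU.exists_basicOpen_le ⟨x, hx⟩ (hV hx)
  refine ⟨S.X.basicOpen f, S.X.basicOpen_le f, hf, hxf, S.mem_center_of_commute hU f _ fun b => ?_⟩
  exact (show Commute b a from Subring.mem_center_iff.1 ha b).map _

lemma centralPresheaf_isSheaf : S.centralPresheaf.IsSheaf := by
  rw [TopCat.Presheaf.isSheaf_iff_isSheafUniqueGluing]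
  intro ι U sf hsf
  obtain ⟨s, hs, hs'⟩ := TopCat.Sheaf.existsUnique_gluing S.A U (fun i => (sf i).1)
    fun i j => congr_arg Subtype.val (hsf i j)
  have hs₁ (i) : S.ringRes (le_iSup U i) s = (sf i).1 := hs i
  have hmem : s ∈ S.centralSections (iSup U) := by
    refine S.mem_centralSections_of_locally fun V hV x hx => ?_
    obtain ⟨i, hi⟩ := Opens.mem_iSup.1 (hV hx)
    refine ⟨V ⊓ U i, inf_le_left.trans hV, inf_le_left, ⟨hx, hi⟩, ?_⟩
    rw [← S.ringRes_ringRes (le_iSup U i) inf_le_right, hs₁]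
    exact S.mem_centralSections_iff.1 (sf i).2 _ _
  refine ⟨⟨s, hmem⟩, fun i => Subtype.ext (hs i), fun t ht => Subtype.ext (hs' t.1 fun i => ?_)⟩
  exact congr_arg Subtype.val (ht i)

lemma centralSheaf_isCoherent (h : S.centralPresheaf.IsSheaf) :
    IsCoherentModule (algebraAsModule (S.centralSheafStructure h)) := by
  let M : S.X.Modules := algebraAsModule S.φ
  let Z : S.X.Modules := algebraAsModule (S.centralSheafStructure h)
  constructor
  · refine Z.isQuasicoherent_of_isLocalizingOnAffines fun U hU f => ⟨fun s => ?_, fun t ht => ?_⟩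
    · obtain ⟨G, hG⟩ := S.exists_finset_generators hU
      obtain ⟨s, hs⟩ : S.centralSections (S.X.basicOpen f) := s
      obtain ⟨n, t, ht⟩ := S.exists_pow_mul_eq_ringRes hU f s
      -- The commutator vanishes on `D(f)`, where `t` is a power of `f` times the central `s`.
      have hcomm (g) : ∃ m : ℕ, S.str U f ^ m * (g * t - t * g) = 0 := by
        refine S.exists_pow_mul_eq_zero hU f _ ?_
        have hc : S.ringRes (S.X.basicOpen_le f) (S.str U f) ∈ Subring.center _ := by
          rw [ringRes_str]
          exact S.map_mem_center _ _
        have h₁ := Subring.mem_center_iff.1 (mul_mem (pow_mem hc n)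
          (S.mem_center_of_mem_centralSections hs)) (S.ringRes (S.X.basicOpen_le f) g)
        rw [map_sub, map_mul, map_mul, ht, h₁, sub_self]
      choose m hm using hcomm
      obtain ⟨N, hN⟩ : ∃ N, ∀ g ∈ G, m g ≤ N := ⟨G.sup m, fun g hg => Finset.le_sup hg⟩
      -- The numerator `t` need not be central; the extra factor `f ^ N` makes it commute with every
      -- generator.
      have hc : S.str U f ^ N * t ∈ Subring.center (S.A.obj.obj (op U)) := by
        have hf (k : ℕ) (b : S.A.obj.obj (op U)) : Commute (S.str U f ^ k) b :=
          Commute.pow_left (S.str_mul_comm f b) k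
        have hT := hG (Subring.centralizer {S.str U f ^ N * t}) (fun r => ?_) (fun g hg => ?_)
        · rw [Subring.mem_center_iff]
          exact fun b => (Subring.mem_centralizer_iff.1 (hT b) _ rfl).symm
        · rw [Subring.mem_centralizer_iff]
          exact fun _ _ => (S.str_mul_comm r _).symm
        · rw [Subring.mem_centralizer_iff]
          rintro _ rfl
          have h₁ : S.str U f ^ N * (g * t - t * g) = 0 := by
            rw [← Nat.sub_add_cancel (hN g hg), pow_add, mul_assoc, hm, mul_zero]
          rw [mul_sub, sub_eq_zero] at h₁
          rw [mul_assoc, ← h₁, ← mul_assoc, ← mul_assoc, (hf N g).eq]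
      refine ⟨N + n, ⟨_, S.mem_centralSections_of_mem_center hU hc⟩, Subtype.ext ?_⟩
      change S.ringRes (S.X.basicOpen_le f) (S.str U f ^ N * t) =
        S.str _ (S.X.presheaf.map (homOfLE (S.X.basicOpen_le f)).op f ^ (N + n)) * s
      rw [map_mul, map_pow, map_pow, ht, ringRes_str, pow_add, mul_assoc]
    · obtain ⟨t, ht'⟩ : S.centralSections U := t
      obtain ⟨n, hn⟩ := S.exists_pow_mul_eq_zero hU f t (congr_arg Subtype.val ht)
      refine ⟨n, Subtype.ext ?_⟩
      change S.str U (f ^ n) * t = 0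
      rw [map_pow, hn]
  · intro U hU
    have := S.isNoetherian
    have : IsNoetherianRing Γ(S.X, U) := IsLocallyNoetherian.component_noetherian ⟨U, hU⟩
    have : Module.Finite Γ(S.X, U) Γ(M, U) := S.isCoherent.2 U hU
    let i : Γ(Z, U) →ₗ[Γ(S.X, U)] Γ(M, U) :=
      { toFun := fun z => (show S.centralSections U from z).1
        map_add' := fun _ _ => rfl
        map_smul' := fun _ _ => rfl }
    have hZ : Module.Finite Γ(S.X, U) Γ(Z, U) := .of_injective i Subtype.val_injective
    exact hZ

/-! ### Stalks. -/

lemma centralStalkMap_injective (x : S.X) : Function.Injective (S.centralStalkMap x) :=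
  TopCat.Presheaf.stalkFunctor_map_injective_of_app_injective
    (fun _ => Subtype.val_injective) x

lemma centralStalkMap_germ {x : S.X} {U : S.X.Opens} (hx : x ∈ U) (c : S.centralSections U) :
    S.centralStalkMap x (S.centralPresheaf.germ U x hx c) =
      S.algebraPresheaf.germ U x hx c.1 :=
  TopCat.Presheaf.stalkFunctor_map_germ_apply U x hx S.centralInclusion c

lemma germ_ringRes {x : S.X} {U V : S.X.Opens} (h : V ≤ U) (hx : x ∈ V)
    (a : S.A.obj.obj (op U)) :
    S.algebraPresheaf.germ V x hx (S.ringRes h a) = S.algebraPresheaf.germ U x (h hx) a :=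
  TopCat.Presheaf.germ_res_apply S.algebraPresheaf (homOfLE h) x hx a

lemma centralStalkMap_mem_center (x : S.X) (z : S.centralPresheaf.stalk x) :
    S.centralStalkMap x z ∈ Subring.center (S.algebraPresheaf.stalk x) := by
  obtain ⟨U, hxU, c, rfl⟩ := S.centralPresheaf.exists_germ_eq z
  erw [S.centralStalkMap_germ hxU c]
  rw [Subring.mem_center_iff]
  intro b
  obtain ⟨V, hV, hxV, b, rfl⟩ := S.algebraPresheaf.exists_le_germ_eq b hxU
  rw [← S.germ_ringRes hV hxV, ← map_mul, ← map_mul]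
  congr 1
  exact Subring.mem_center_iff.1 (S.mem_centralSections_iff.1 c.2 V hV) b

/-- A representative commutes with each generator near `x`; finiteness of `G` yields one `D(f)` on
which it commutes with all of them. -/
lemma exists_centralStalkMap_eq (x : S.X) {a : S.algebraPresheaf.stalk x}
    (ha : a ∈ Subring.center (S.algebraPresheaf.stalk x)) : ∃ z, S.centralStalkMap x z = a := by
  obtain ⟨U, hU, hxU, -⟩ := exists_isAffineOpen_mem_and_subset (x := x) (U := ⊤) trivial
  obtain ⟨V, hV, hxV, a, rfl⟩ := S.algebraPresheaf.exists_le_germ_eq a hxU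
  obtain ⟨G, hG⟩ := S.exists_finset_generators hU
  have hcomm (g : S.A.obj.obj (op U)) : ∃ W, ∃ hW : W ≤ V, x ∈ W ∧
      S.ringRes hW (S.ringRes hV g * a) = S.ringRes hW (a * S.ringRes hV g) := by
    have h := Subring.mem_center_iff.1 ha (S.algebraPresheaf.germ V x hxV (S.ringRes hV g))
    erw [← map_mul, ← map_mul] at h
    obtain ⟨W, hxW, i, j, h⟩ := S.algebraPresheaf.germ_eq x hxV hxV _ _ h
    exact ⟨W, i.le, hxW, h⟩
  choose W hWV hxW hW using hcomm
  obtain ⟨f, hf, hxf⟩ := hU.exists_basicOpen_le (V := V ⊓ G.inf W)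
    ⟨x, hxV, by simpa [Opens.coe_finset_inf] using fun g _ => hxW g⟩ hxU
  have hfV : S.X.basicOpen f ≤ V := hf.trans inf_le_left
  have hc : S.ringRes hfV a ∈ Subring.center (S.A.obj.obj (op (S.X.basicOpen f))) := by
    refine S.mem_center_of_commute_generators hU hG f _ fun g hg => ?_
    have hfW : S.X.basicOpen f ≤ W g := hf.trans (inf_le_right.trans (Finset.inf_le hg))
    have := congr(S.ringRes hfW $(hW g))
    rwa [ringRes_ringRes, ringRes_ringRes, map_mul, map_mul, ringRes_ringRes] at this
  refine ⟨S.centralPresheaf.germ _ x hxf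
    ⟨_, S.mem_centralSections_of_mem_center (hU.basicOpen f) hc⟩, ?_⟩
  rw [centralStalkMap_germ, germ_ringRes]

/-- The stalk of `Z_A` at `x` is the center of the stalk of `A` at `x`. -/
noncomputable def centralStalkEquiv (x : S.X) :
    S.centralPresheaf.stalk x ≃+* Subring.center (S.algebraPresheaf.stalk x) :=
  RingEquiv.ofBijective ((S.centralStalkMap x).hom.codRestrict _ (S.centralStalkMap_mem_center x))
    ⟨fun _ _ h => S.centralStalkMap_injective x (congr_arg Subtype.val h), fun a => by
      obtain ⟨z, hz⟩ := S.exists_centralStalkMap_eq x a.2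
      exact ⟨z, Subtype.ext hz⟩⟩

end NCNScheme

/-! ### The sheaf `j_* j^* N` for an affine open. -/

namespace TopologicalSpace.Opens

/-- The functor `W ↦ W ⊓ U` on open subsets. -/
def infFunctor {X : TopCat.{u}} (U : Opens X) : Opens X ⥤ Opens X where
  obj W := W ⊓ U
  map f := homOfLE (inf_le_inf_right U f.le)

instance {X : TopCat.{u}} (U : Opens X) : U.infFunctor.IsContinuous
    (Opens.grothendieckTopology X) (Opens.grothendieckTopology X) := by
  have := U.isOpenEmbedding.functor_isContinuous
  have := CategoryTheory.Functor.isContinuous_comp.{u} (Opens.map U.inclusion')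
    U.isOpenEmbedding.isOpenMap.functor (Opens.grothendieckTopology X)
    (Opens.grothendieckTopology _) (Opens.grothendieckTopology X)
  refine Functor.isContinuous_of_iso (F₁ := Opens.map U.inclusion' ⋙
    U.isOpenEmbedding.isOpenMap.functor) (NatIso.ofComponents (fun W => eqToIso ?_)) _ _
  exact Opens.functor_map_eq_inf U W

end TopologicalSpace.Opens

namespace NCNScheme

variable (S : NCNScheme.{u})

/-- The restriction maps `Γ(W, A) → Γ(W ⊓ U, A)`. -/
def toInfPushforward (U : S.X.Opens) : S.A ⟶ (U.infFunctor.sheafPushforwardContinuous RingCat.{u}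
    (Opens.grothendieckTopology S.X) (Opens.grothendieckTopology S.X)).obj S.A where
  hom :=
    { app := fun W => S.A.obj.map (homOfLE inf_le_left).op
      naturality := fun V W f => by
        change S.A.obj.map _ ≫ S.A.obj.map _ = S.A.obj.map _ ≫ S.A.obj.map _
        exact (S.A.obj.map_comp f _).symm.trans (S.A.obj.map_comp (homOfLE inf_le_left).op
          (homOfLE (inf_le_inf_right U f.unop.le)).op) }

variable {S}

/-- The sheaf `j_* j^* N` for the inclusion `j` of an open subset `U`; its sections over `W` are
the sections of `N` over `W ⊓ U`. -/
noncomputable def infPushforward (N : SheafOfModules.{u} S.A) (U : S.X.Opens) :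
    SheafOfModules.{u} S.A :=
  (SheafOfModules.pushforward (S.toInfPushforward U)).obj N

/-- The identification of the sections of `j_* j^* N`. -/
noncomputable def infPushforwardSections (N : SheafOfModules.{u} S.A) (U W : S.X.Opens) :
    (infPushforward N U).val.obj (op W) ≃+ N.val.obj (op (W ⊓ U)) :=
  AddEquiv.refl _

lemma infPushforwardSections_smul (N : SheafOfModules.{u} S.A) (U W : S.X.Opens)
    (a : S.A.obj.obj (op W)) (m : (infPushforward N U).val.obj (op W)) :
    infPushforwardSections N U W (a • m) =
      S.ringRes (inf_le_left : W ⊓ U ≤ W) a • infPushforwardSections N U W m := rfl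

lemma infPushforwardSections_secRes (N : SheafOfModules.{u} S.A) (U : S.X.Opens)
    {V W : S.X.Opens} (h : V ≤ W) (m : (infPushforward N U).val.obj (op W)) :
    infPushforwardSections N U V (secRes _ h m) =
      secRes N (inf_le_inf_right U h) (infPushforwardSections N U W m) := rfl

/-- Separatedness makes `V ⊓ U` affine, and `D(f) ⊓ U` is the basic open of `f` restricted to `V ⊓
U`, so the localization property of `N` there applies. -/
lemma isQcoh_infPushforward {N : SheafOfModules.{u} S.A} (hN : S.isQcoh N) {U : S.X.Opens}
    (hU : IsAffineOpen U) : S.isQcoh (infPushforward N U) := by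
  have := S.isSeparated
  rw [isQcoh_iff] at hN ⊢
  intro V hV f
  have hVU : IsAffineOpen (V ⊓ U) := hV.inf hU
  let g : Γ(S.X, V ⊓ U) := S.X.presheaf.map (homOfLE inf_le_left).op f
  have hg : S.X.basicOpen g = S.X.basicOpen f ⊓ U := by
    rw [Scheme.basicOpen_res, inf_assoc, inf_comm U, ← inf_assoc,
      inf_eq_right.2 (S.X.basicOpen_le f)]
  obtain ⟨h₁, h₂⟩ := hN hVU g
  have hgf (n : ℕ) : S.ringRes inf_le_left (S.str V f ^ n) = S.str (V ⊓ U) g ^ n := by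
    rw [map_pow, ringRes_str]
  refine ⟨fun s => ?_, fun t ht => ?_⟩
  · obtain ⟨n, t, ht⟩ := h₁ (secRes N hg.le (infPushforwardSections N U _ s))
    refine ⟨n, (infPushforwardSections N U V).symm t, (infPushforwardSections N U _).injective ?_⟩
    rw [infPushforwardSections_secRes, infPushforwardSections_smul, AddEquiv.apply_symm_apply,
      ← secRes_secRes N (S.X.basicOpen_le g) hg.ge, ht, secRes_smul, secRes_secRes, secRes_self,
      ← map_pow (S.ringRes _), ← map_pow (S.ringRes _), ringRes_ringRes, ringRes_ringRes, ← hgf, ringRes_ringRes]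
  · obtain ⟨n, hn⟩ := h₂ (infPushforwardSections N U V t) (by
      rw [← secRes_secRes N (inf_le_inf_right U (S.X.basicOpen_le f) : _ ≤ V ⊓ U) hg.le,
        ← infPushforwardSections_secRes N U (S.X.basicOpen_le f), ht, map_zero, map_zero])
    refine ⟨n, (infPushforwardSections N U V).injective ?_⟩
    rw [infPushforwardSections_smul, hgf, hn, map_zero]

/-- The restriction map `Γ(W, N) → Γ(W ⊓ U, N)` as an `A`-linear map to the sections of
`j_* j^* N`. -/
noncomputable def toInfPushforwardLinear (N : SheafOfModules.{u} S.A) (U W : S.X.Opens) :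
    N.val.obj (op W) →ₗ[S.A.obj.obj (op W)] (infPushforward N U).val.obj (op W) where
  toFun m := (infPushforwardSections N U W).symm (secRes N inf_le_left m)
  map_add' m n := by rw [map_add, map_add]
  map_smul' a m := secRes_smul N inf_le_left a m

/-- `toInfPushforwardLinear` as a morphism in the category of modules. -/
noncomputable def toInfPushforwardApp (N : SheafOfModules.{u} S.A) (U W : S.X.Opens) :
    N.val.obj (op W) ⟶ (infPushforward N U).val.obj (op W) :=
  let f : ModuleCat.of _ (N.val.obj (op W)) ⟶ ModuleCat.of _ ((infPushforward N U).val.obj (op W)) :=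
    ModuleCat.ofHom (toInfPushforwardLinear N U W)
  f

/-- The canonical map `N ⟶ j_* j^* N`. -/
noncomputable def toInfPushforwardModule (N : SheafOfModules.{u} S.A) (U : S.X.Opens) :
    N ⟶ infPushforward N U where
  val :=
    { app := fun W => toInfPushforwardApp N U W.unop
      naturality := fun {V W} f => by
        ext m
        exact (secRes_secRes N f.unop.le inf_le_left m).trans
          (secRes_secRes N inf_le_left (inf_le_inf_right U f.unop.le) m).symm }

lemma infPushforwardSections_toInfPushforwardModule (N : SheafOfModules.{u} S.A)
    (U W : S.X.Opens) (m : N.val.obj (op W)) :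
    infPushforwardSections N U W ((toInfPushforwardModule N U).val.app (op W) m) =
      secRes N inf_le_left m := rfl

/-- The morphism `A ⟶ N` which sends `1` to the global section `m`. -/
noncomputable def homOfGlobalSection (N : SheafOfModules.{u} S.A) (m : N.val.obj (op ⊤)) :
    SheafOfModules.unit S.A ⟶ N :=
  N.unitHomEquiv.symm (PresheafOfModules.sectionsMk (fun _ => secRes N le_top m)
    fun _ _ f => secRes_secRes N le_top f.unop.le m)

lemma homOfGlobalSection_app (N : SheafOfModules.{u} S.A) (m : N.val.obj (op ⊤))
    (a : S.A.obj.obj (op ⊤)) : (homOfGlobalSection N m).val.app (op ⊤) a = a • m := by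
  refine congr_arg (a • ·) (secRes_self N le_top m)

end NCNScheme

/-! ### The categorical center. -/

namespace NCNScheme

variable {S : NCNScheme.{u}}

lemma app_secRes {M N : SheafOfModules.{u} S.A} (g : M ⟶ N) {U V : S.X.Opens} (h : V ≤ U)
    (m : M.val.obj (op U)) :
    g.val.app (op V) (secRes M h m) = secRes N h (g.val.app (op U) m) :=
  PresheafOfModules.naturality_apply g.val (homOfLE h).op m

lemma app_smul {M N : SheafOfModules.{u} S.A} (g : M ⟶ N) {U : S.X.Opens}
    (a : S.A.obj.obj (op U)) (m : M.val.obj (op U)) :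
    g.val.app (op U) (a • m) = a • g.val.app (op U) m :=
  (g.val.app (op U)).hom.map_smul a m

variable (S) in
/-- The object `A` of the category of quasi-coherent `A`-modules. -/
noncomputable def unitQcoh : S.Qcoh := ⟨SheafOfModules.unit S.A, S.isQcoh_unit⟩

/-- The unit section of `A` as a section of the `A`-module `A`. -/
noncomputable def unitOne (U : S.X.Opens) : (SheafOfModules.unit S.A).val.obj (op U) :=
  (1 : S.A.obj.obj (op U))

variable (S) in
lemma upsilon_injective : Function.Injective S.upsilon := by
  intro a b hab
  have h := congr(($(hab).app S.unitQcoh).hom.val.app (op ⊤) (unitOne ⊤))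
  change S.res ⊤ a.1 * 1 = S.res ⊤ b.1 * 1 at h
  rw [mul_one, mul_one] at h
  exact Subtype.ext (((S.ringRes_self le_rfl a.1).symm.trans h).trans (S.ringRes_self le_rfl b.1))

/-- The global section by which an element of the categorical center acts. -/
noncomputable def globalSection (ζ : CatCenter S.Qcoh) : S.A.obj.obj (op ⊤) :=
  (ζ.app S.unitQcoh).hom.val.app (op ⊤) (unitOne ⊤)

/-- An element of the categorical center acts on global sections as multiplication. -/
lemma app_globalSection (ζ : CatCenter S.Qcoh) (N : S.Qcoh) (m : N.obj.val.obj (op ⊤)) :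
    (ζ.app N).hom.val.app (op ⊤) m = globalSection ζ • m := by
  let g : S.unitQcoh ⟶ N := ObjectProperty.homMk (homOfGlobalSection N.obj m)
  have h := congr($(ζ.naturality g).hom.val.app (op ⊤) (unitOne ⊤))
  change (ζ.app N).hom.val.app (op ⊤) ((homOfGlobalSection N.obj m).val.app (op ⊤) (unitOne ⊤)) =
    (homOfGlobalSection N.obj m).val.app (op ⊤) (globalSection ζ) at h
  rw [homOfGlobalSection_app, unitOne] at h
  erw [homOfGlobalSection_app] at h
  rwa [one_smul] at h

/-- An element of the categorical center acts on sections over affine opens as multiplication. -/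
lemma app_of_isAffineOpen (ζ : CatCenter S.Qcoh) (N : S.Qcoh) {U : S.X.Opens}
    (hU : IsAffineOpen U) (m : N.obj.val.obj (op U)) :
    (ζ.app N).hom.val.app (op U) m = S.ringRes (le_top : U ≤ ⊤) (globalSection ζ) • m := by
  let N' : S.Qcoh := ⟨infPushforward N.obj U, isQcoh_infPushforward N.property hU⟩
  let g : N ⟶ N' := ObjectProperty.homMk (toInfPushforwardModule N.obj U)
  let m' : N'.obj.val.obj (op ⊤) :=
    (infPushforwardSections N.obj U ⊤).symm (secRes N.obj inf_le_right m)
  -- In `j_* j^* N` the section `m` extends to a global one, on which the action of `ζ` is known.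
  have hm' : (toInfPushforwardModule N.obj U).val.app (op U) m = secRes N'.obj le_top m' := by
    apply (infPushforwardSections N.obj U U).injective
    rw [infPushforwardSections_toInfPushforwardModule]
    erw [infPushforwardSections_secRes]
    rw [AddEquiv.apply_symm_apply, secRes_secRes]
  have h := congr($(ζ.naturality g).hom.val.app (op U) m)
  change (ζ.app N').hom.val.app (op U) ((toInfPushforwardModule N.obj U).val.app (op U) m) =
    (toInfPushforwardModule N.obj U).val.app (op U) ((ζ.app N).hom.val.app (op U) m) at h
  rw [hm', app_secRes, app_globalSection, secRes_smul, ← hm', ← app_smul] at h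
  -- Over `U` itself `N ⟶ j_* j^* N` is injective: restricting back along `U ≤ U ⊓ U` undoes it.
  have h' := congr(secRes N.obj (le_inf le_rfl le_rfl) (infPushforwardSections N.obj U U $h))
  rw [infPushforwardSections_toInfPushforwardModule,
    infPushforwardSections_toInfPushforwardModule, secRes_secRes, secRes_secRes, secRes_self,
    secRes_self] at h'
  exact h'.symm

lemma globalSection_mem (ζ : CatCenter S.Qcoh) : globalSection ζ ∈ S.centralSections ⊤ := by
  refine S.mem_centralSections_of_locally fun V _ x hx => ?_
  obtain ⟨U, hU, hxU, hUV⟩ := exists_isAffineOpen_mem_and_subset (x := x) (U := V) hx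
  refine ⟨U, le_top, hUV, hxU, Subring.mem_center_iff.2 fun b => ?_⟩
  -- Compute `ζ` on `b • 1` both as multiplication by the global section and by linearity.
  have h₁ := app_of_isAffineOpen ζ S.unitQcoh hU (b • unitOne U)
  have h₂ := app_of_isAffineOpen ζ S.unitQcoh hU (unitOne U)
  have h₃ := app_smul (ζ.app S.unitQcoh).hom b (unitOne U)
  have h := (congr(b • $h₂).symm.trans h₃.symm).trans h₁
  change b * (S.ringRes _ _ * 1) = S.ringRes _ _ * (b * 1) at h
  rwa [mul_one, mul_one] at h

variable (S) in
lemma upsilon_surjective : Function.Surjective S.upsilon := by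
  intro ζ
  refine ⟨⟨globalSection ζ, globalSection_mem ζ⟩, ?_⟩
  ext N W m
  refine section_ext N.obj fun x hx => ?_
  obtain ⟨U, hU, hxU, hUW⟩ := exists_isAffineOpen_mem_and_subset (x := x) hx
  refine ⟨U, hUW, hxU, ?_⟩
  erw [← app_secRes, ← app_secRes]
  exact (app_of_isAffineOpen ζ N hU _).symm

end NCNScheme

/-- For a non-commutative noetherian scheme `S = (X, A)`, the presheaf `Z_A` is a sheaf, coherent
as an `𝒪`-module; the inclusion `Z_A ⟶ A` identifies its stalk at each `x` with the center of
`A_x`; and the canonical ring homomorphism `Γ(X, Z_A) → Z(Qcoh(X, A))` is bijective. -/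
theorem propositionP (S : NCNScheme.{u}) :
    (∃ h : S.centralPresheaf.IsSheaf,
      IsCoherentModule (algebraAsModule (S.centralSheafStructure h))) ∧
    (∀ x : S.X, ∃ e : S.centralPresheaf.stalk x ≃+*
        Subring.center (S.algebraPresheaf.stalk x),
      ∀ z, (e z : S.algebraPresheaf.stalk x) = S.centralStalkMap x z) ∧
    Function.Bijective S.upsilon :=
  ⟨⟨S.centralPresheaf_isSheaf, S.centralSheaf_isCoherent _⟩,
    fun x => ⟨S.centralStalkEquiv x, fun _ => rfl⟩, S.upsilon_injective, S.upsilon_surjective⟩
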